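/- Let $G$ be a finite connected graph with node set $\mathcal N$, without self-loops or multiple links, in which every link $(i,j)$ carries a weight $c_{ij}=c_{ji}>0$, and put $c_{ij}=0$ when $i,j$ are not linked. Let $Q$ be its weighted Laplacian, $Q_{ii}=\sum_k c_{ik}$ and $Q_{ij}=-c_{ij}$ for $i\neq j$, let $Q^\dagger$ be the Moore–Penrose inverse of $Q$, and let $\omega_{ij}=(e_i-e_j)^{T}Q^\dagger(e_i-e_j)$ be the effective resistance. For a probability distribution $p$ on $\mathcal N$ put $\operatorname{var}_\omega(p)=\tfrac12\sum_{i,j}p_ip_j\,\omega_{ij}$. Then there is exactly one probability distribution $p^\star$ that maximizes $\operatorname{var}_\omega$ over all probability distributions on $\mathcal N$. Let $\mathcal V^\star=\{i\in\mathcal N: p^\star_i>0\}$ be its support. For any two distinct nodes $a,b$ the following are equivalent: 1. $\mathcal V^\star=\{a,b\}$; 2. $G$ (with its weights disregarded) is a path graph whose two ends are $a$ and $b$; 3. $\omega_{ax}+\omega_{xb}=\omega_{ab}$ for every node $x\notin\{a,b\}$. In particular, $\mathcal V^\star$ consists of exactly two nodes if and only if $G$ is a path graph with at least two nodes. -/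

import Mathlib

/-! ### The Moore–Penrose inverse of a real matrix -/

/-- `X` satisfies the four Penrose equations for `A`. -/
structure IsMoorePenroseInverse {m n : Type*} [Fintype m] [Fintype n]
    (A : Matrix m n ℝ) (X : Matrix n m ℝ) : Prop where
  mul_mul_left : A * X * A = A
  mul_mul_right : X * A * X = X
  symm_left : (A * X).transpose = A * X
  symm_right : (X * A).transpose = X * A

theorem IsMoorePenroseInverse.unique {m n : Type*} [Fintype m] [Fintype n]
    {A : Matrix m n ℝ} {X Y : Matrix n m ℝ}
    (hX : IsMoorePenroseInverse A X) (hY : IsMoorePenroseInverse A Y) : X = Y := by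
  have h1 : A * X = A * Y := by
    have e : (A * Y * (A * X)).transpose = A * X * (A * Y) := by
      rw [Matrix.transpose_mul, hX.symm_left, hY.symm_left]
    rw [← Matrix.mul_assoc, hY.mul_mul_left, ← Matrix.mul_assoc, hX.mul_mul_left,
      hX.symm_left] at e
    exact e
  have h2 : X * A = Y * A := by
    have e : (X * A * (Y * A)).transpose = Y * A * (X * A) := by
      rw [Matrix.transpose_mul, hX.symm_right, hY.symm_right]
    rw [Matrix.mul_assoc, ← Matrix.mul_assoc A, hY.mul_mul_left, Matrix.mul_assoc Y,
      ← Matrix.mul_assoc A, hX.mul_mul_left, hX.symm_right] at e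
    exact e
  calc X = X * A * X := hX.mul_mul_right.symm
    _ = Y * A * X := by rw [h2]
    _ = Y * (A * X) := Matrix.mul_assoc _ _ _
    _ = Y * A * Y := by rw [h1, Matrix.mul_assoc]
    _ = Y := hY.mul_mul_right

theorem exists_isMoorePenroseInverse_of_isHermitian {n : Type*} [Fintype n] [DecidableEq n]
    {A : Matrix n n ℝ} (hA : A.IsHermitian) :
    ∃ X : Matrix n n ℝ, IsMoorePenroseInverse A X := by
  obtain ⟨U, d, hU, hAe⟩ : ∃ (U : Matrix n n ℝ) (d : n → ℝ),
      U.transpose * U = 1 ∧ A = U * Matrix.diagonal d * U.transpose := by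
    refine ⟨(hA.eigenvectorUnitary : Matrix n n ℝ), hA.eigenvalues, ?_, ?_⟩
    · have := Matrix.mem_unitaryGroup_iff'.1 hA.eigenvectorUnitary.2
      simpa [Matrix.star_eq_conjTranspose, Matrix.conjTranspose_eq_transpose_of_trivial] using this
    · have := hA.spectral_theorem
      simpa [Unitary.conjStarAlgAut_apply, Matrix.star_eq_conjTranspose,
        Matrix.conjTranspose_eq_transpose_of_trivial, Function.comp_def] using this
  have key : ∀ a b : n → ℝ, U * Matrix.diagonal a * U.transpose *
      (U * Matrix.diagonal b * U.transpose) =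
        U * Matrix.diagonal (fun i => a i * b i) * U.transpose := by
    intro a b
    calc _ = U * Matrix.diagonal a * (U.transpose * U) * Matrix.diagonal b * U.transpose := by
          simp only [Matrix.mul_assoc]
      _ = _ := by
          rw [hU, Matrix.mul_one, Matrix.mul_assoc U, Matrix.diagonal_mul_diagonal]
  have keyT : ∀ a : n → ℝ, (U * Matrix.diagonal a * U.transpose).transpose =
      U * Matrix.diagonal a * U.transpose := by
    intro a
    simp [Matrix.transpose_mul, Matrix.mul_assoc]
  refine ⟨U * Matrix.diagonal (fun i => (d i)⁻¹) * U.transpose, ?_, ?_, ?_, ?_⟩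
  · rw [hAe, key, key]
    simp
  · rw [hAe, key, key]
    congr 3
    funext i
    by_cases h : d i = 0 <;> simp [h]
  · rw [hAe, key, keyT]
  · rw [hAe, key, keyT]

theorem IsMoorePenroseInverse.transpose_eq {n : Type*} [Fintype n]
    {A X : Matrix n n ℝ} (hX : IsMoorePenroseInverse A X) (hA : A.transpose = A) :
    X.transpose = X := by
  have h1 : (A * X).transpose = X.transpose * A := by rw [Matrix.transpose_mul, hA]
  have h2 : (X * A).transpose = A * X.transpose := by rw [Matrix.transpose_mul, hA]
  refine IsMoorePenroseInverse.unique (A := A) ⟨?_, ?_, ?_, ?_⟩ hX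
  · have := congrArg Matrix.transpose hX.mul_mul_left
    rwa [Matrix.transpose_mul, h1, hA, ← Matrix.mul_assoc] at this
  · have := congrArg Matrix.transpose hX.mul_mul_right
    rwa [Matrix.transpose_mul, h2, ← Matrix.mul_assoc] at this
  · rw [← h2, hX.symm_right, hX.symm_right]
  · rw [← h1, hX.symm_left, hX.symm_left]

theorem exists_isMoorePenroseInverse {m n : Type*} [Fintype m] [Fintype n]
    (A : Matrix m n ℝ) : ∃ X : Matrix n m ℝ, IsMoorePenroseInverse A X := by
  classical
  have hH : (A.transpose * A).IsHermitian := by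
    rw [← Matrix.conjTranspose_eq_transpose_of_trivial]
    exact Matrix.isHermitian_conjTranspose_mul_self A
  have hHT : (A.transpose * A).transpose = A.transpose * A := by
    simp [Matrix.transpose_mul]
  obtain ⟨B, hB⟩ := exists_isMoorePenroseInverse_of_isHermitian hH
  have hBT : B.transpose = B := hB.transpose_eq hHT
  have h1 : A * B * (A.transpose * A) = A := by
    have e1 : A.transpose * (A * (B * (A.transpose * A) - 1)) = 0 := by
      rw [← Matrix.mul_assoc, Matrix.mul_sub, ← Matrix.mul_assoc (A.transpose * A) B,
        hB.mul_mul_left, Matrix.mul_one, sub_self]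
    have h0 : (A * (B * (A.transpose * A) - 1)).conjTranspose *
        (A * (B * (A.transpose * A) - 1)) = 0 := by
      rw [Matrix.conjTranspose_eq_transpose_of_trivial, Matrix.transpose_mul, Matrix.mul_assoc,
        e1, Matrix.mul_zero]
    have h2 := Matrix.conjTranspose_mul_self_eq_zero.1 h0
    rw [Matrix.mul_sub, Matrix.mul_one, ← Matrix.mul_assoc] at h2
    exact sub_eq_zero.1 h2
  refine ⟨B * A.transpose, ?_, ?_, ?_, ?_⟩
  · rw [← Matrix.mul_assoc, Matrix.mul_assoc, h1]
  · have := hB.mul_mul_right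
    calc _ = B * (A.transpose * A) * B * A.transpose := by simp only [Matrix.mul_assoc]
      _ = _ := by rw [this]
  · simp [Matrix.transpose_mul, hBT, Matrix.mul_assoc]
  · rw [Matrix.mul_assoc, hB.symm_right]

/-- The Moore–Penrose inverse of a real matrix. -/
noncomputable def moorePenroseInverse {m n : Type*} [Fintype m] [Fintype n]
    (A : Matrix m n ℝ) : Matrix n m ℝ :=
  (exists_isMoorePenroseInverse A).choose

theorem isMoorePenroseInverse_moorePenroseInverse {m n : Type*} [Fintype m] [Fintype n]
    (A : Matrix m n ℝ) : IsMoorePenroseInverse A (moorePenroseInverse A) :=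
  (exists_isMoorePenroseInverse A).choose_spec

/-! ### Weighted graphs, effective resistance, variance -/

/-- A simple graph whose links carry positive real weights; the weight of a pair of nodes that is
not a link is `0`. -/
structure WeightedGraph (V : Type*) where
  graph : SimpleGraph V
  weight : V → V → ℝ
  weight_symm : ∀ i j, weight i j = weight j i
  weight_pos : ∀ i j, graph.Adj i j → 0 < weight i j
  weight_eq_zero : ∀ i j, ¬ graph.Adj i j → weight i j = 0

namespace WeightedGraph

/-- The graph is a path whose ends are `a` and `b`. -/
def IsPathWithEnds {V : Type*} (G : WeightedGraph V) (a b : V) : Prop :=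
  ∃ (n : ℕ) (e : SimpleGraph.pathGraph (n + 1) ≃g G.graph), e 0 = a ∧ e (Fin.last n) = b

variable {V : Type*} [Fintype V] [DecidableEq V]

/-- The weighted Laplacian matrix `Q`. -/
def laplacian (G : WeightedGraph V) : Matrix V V ℝ :=
  Matrix.of fun i j => if i = j then ∑ k, G.weight i k else -G.weight i j

/-- The effective resistance `ω i j = (eᵢ - eⱼ)ᵀ Q† (eᵢ - eⱼ)`. -/
noncomputable def resistance (G : WeightedGraph V) (i j : V) : ℝ :=
  (Pi.single i 1 - Pi.single j 1 : V → ℝ) ⬝ᵥ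
    (moorePenroseInverse G.laplacian).mulVec (Pi.single i 1 - Pi.single j 1 : V → ℝ)

/-- The variance `½ ∑ᵢⱼ pᵢ pⱼ d(i,j)²` of `p` for the distance `d = √ω`, that is,
`½ pᵀ Ω p` with `Ω = (ωᵢⱼ)`. -/
noncomputable def variance (G : WeightedGraph V) (p : V → ℝ) : ℝ :=
  (1 / 2) * ∑ i, ∑ j, p i * p j * G.resistance i j

/-- `p` is a probability distribution on the nodes that has the largest variance among all
probability distributions on the nodes. -/
def IsMaxVarianceDistribution (G : WeightedGraph V) (p : V → ℝ) : Prop :=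
  p ∈ stdSimplex ℝ V ∧ ∀ q ∈ stdSimplex ℝ V, G.variance q ≤ G.variance p

end WeightedGraph

namespace WeightedGraph

open Matrix

/-! On vectors `d` with zero sum, the second-order term of the variance is `-dᵀ Q† d`
(`variance_add_smul`). Connectedness makes it negative definite, so the variance is strictly concave
on the simplex: the maximizer is unique, and it is characterized by first-order conditions on
`meanResistance`. If the support is `{a, b}`, these conditions force masses 1/2 and equality in the
triangle inequality at every other node; conversely, equality makes the fair distribution on `a, b`
optimal.

The defect in the triangle inequality is twice the potential at `a` of a unit current from `b` to
`x` (`potential_eq`). It vanishes exactly when `x` separates `a` from `b`. If every other node does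
so, a shortest path from `a` to `b` visits all nodes and has no chords, hence is the whole graph.

Definiteness, the minimum principle and the separation argument all rest on
`eq_of_dotProduct_laplacian_mulVec_nonpos`. -/

theorem weight_nonneg {V : Type*} (G : WeightedGraph V) (i j : V) : 0 ≤ G.weight i j := by
  by_cases h : G.graph.Adj i j
  · exact (G.weight_pos i j h).le
  · exact (G.weight_eq_zero i j h).ge

theorem sum_sub_eq_zero_of_mem_stdSimplex {V : Type*} [Fintype V] {p q : V → ℝ}
    (hp : p ∈ stdSimplex ℝ V) (hq : q ∈ stdSimplex ℝ V) : ∑ i, (q - p) i = 0 := by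
  simp [Finset.sum_sub_distrib, hp.2, hq.2]

/-! ### Energy form of the Laplacian and its pseudoinverse on zero-sum vectors -/

section Laplacian

variable {V : Type*} [Fintype V] [DecidableEq V] (G : WeightedGraph V)

theorem laplacian_transpose : G.laplacian.transpose = G.laplacian := by
  ext i j
  by_cases h : i = j
  · subst h; rfl
  · simp [laplacian, h, Ne.symm h, G.weight_symm i j]

theorem laplacian_mulVec (f : V → ℝ) (i : V) :
    (G.laplacian *ᵥ f) i = ∑ j, G.weight i j * (f i - f j) := by
  have h : ∀ j, G.laplacian i j * f j =
      (if i = j then (∑ k, G.weight i k) * f i else 0) - G.weight i j * f j := by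
    intro j
    by_cases h : i = j
    · subst h
      simp [laplacian, G.weight_eq_zero i i (G.graph.irrefl)]
    · simp [laplacian, h]
  simp only [mulVec, dotProduct, h, Finset.sum_sub_distrib, mul_sub, Finset.sum_mul,
    Finset.sum_ite_eq, Finset.mem_univ, if_true]

theorem dotProduct_laplacian_mulVec (g f : V → ℝ) :
    g ⬝ᵥ (G.laplacian *ᵥ f) =
      (1 / 2) * ∑ i, ∑ j, G.weight i j * ((g i - g j) * (f i - f j)) := by
  have h1 : g ⬝ᵥ (G.laplacian *ᵥ f) = ∑ i, ∑ j, G.weight i j * (g i * (f i - f j)) := by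
    simp only [dotProduct, laplacian_mulVec, Finset.mul_sum]
    exact Finset.sum_congr rfl fun i _ => Finset.sum_congr rfl fun j _ => by ring
  have h2 : g ⬝ᵥ (G.laplacian *ᵥ f) = ∑ i, ∑ j, G.weight i j * (g j * (f j - f i)) := by
    rw [h1, Finset.sum_comm]
    exact Finset.sum_congr rfl fun i _ => Finset.sum_congr rfl fun j _ => by
      rw [G.weight_symm j i]
  have h3 : ∑ i, ∑ j, G.weight i j * ((g i - g j) * (f i - f j)) =
      ∑ i, ∑ j, G.weight i j * (g i * (f i - f j)) +
        ∑ i, ∑ j, G.weight i j * (g j * (f j - f i)) := by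
    simp only [← Finset.sum_add_distrib]
    exact Finset.sum_congr rfl fun i _ => Finset.sum_congr rfl fun j _ => by ring
  rw [h3, ← h1, ← h2]
  ring

theorem dotProduct_laplacian_mulVec_self_nonneg (f : V → ℝ) :
    0 ≤ f ⬝ᵥ (G.laplacian *ᵥ f) := by
  rw [dotProduct_laplacian_mulVec]
  exact mul_nonneg (by norm_num) (Finset.sum_nonneg fun i _ => Finset.sum_nonneg fun j _ =>
    mul_nonneg (G.weight_nonneg i j) (mul_self_nonneg _))

variable {G}

/-- If the energy pairing of `g` with `f` dominates the energy of `g` link by link and is not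
positive, then `g` is constant. -/
theorem eq_of_dotProduct_laplacian_mulVec_nonpos (hG : G.graph.Connected) {g f : V → ℝ}
    (hgf : ∀ i j, G.graph.Adj i j → (g i - g j) ^ 2 ≤ (g i - g j) * (f i - f j))
    (h : g ⬝ᵥ (G.laplacian *ᵥ f) ≤ 0) (i j : V) : g i = g j := by
  have hnn : ∀ i j, 0 ≤ G.weight i j * ((g i - g j) * (f i - f j)) := by
    intro i j
    by_cases hij : G.graph.Adj i j
    · exact mul_nonneg (G.weight_nonneg i j) ((sq_nonneg _).trans (hgf i j hij))
    · simp [G.weight_eq_zero i j hij]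
  rw [dotProduct_laplacian_mulVec] at h
  have h0 : ∑ i, ∑ j, G.weight i j * ((g i - g j) * (f i - f j)) = 0 :=
    le_antisymm (by linarith)
      (Finset.sum_nonneg fun i _ => Finset.sum_nonneg fun j _ => hnn i j)
  have hadj : ∀ i j, G.graph.Adj i j → g i = g j := by
    intro i j hij
    have h1 := (Finset.sum_eq_zero_iff_of_nonneg
      fun i _ => Finset.sum_nonneg fun j _ => hnn i j).1 h0 i (Finset.mem_univ i)
    have h2 := (Finset.sum_eq_zero_iff_of_nonneg fun j _ => hnn i j).1 h1 j (Finset.mem_univ j)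
    have h3 : (g i - g j) * (f i - f j) = 0 :=
      (mul_eq_zero.1 h2).resolve_left (G.weight_pos i j hij).ne'
    have h4 := hgf i j hij
    rw [h3] at h4
    exact sub_eq_zero.1 (pow_eq_zero_iff two_ne_zero |>.1 (le_antisymm h4 (sq_nonneg _)))
  obtain ⟨w⟩ := hG.preconnected i j
  induction w with
  | nil => rfl
  | cons hij _ ih => exact (hadj _ _ hij).trans ih

theorem eq_of_laplacian_mulVec_eq_zero (hG : G.graph.Connected) {f : V → ℝ}
    (h : G.laplacian *ᵥ f = 0) (i j : V) : f i = f j :=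
  eq_of_dotProduct_laplacian_mulVec_nonpos hG (fun i j _ => (sq (f i - f j)).le)
    (by rw [h, dotProduct_zero]) i j

/-- Columns of `M * Q - 1` lie in the kernel of `Q`, hence are constant. Its transpose `Q * M - 1`
has constant rows, which annihilate zero-sum vectors. -/
theorem laplacian_mulVec_pinv (hG : G.graph.Connected) {d : V → ℝ} (hd : ∑ i, d i = 0) :
    G.laplacian *ᵥ (moorePenroseInverse G.laplacian *ᵥ d) = d := by
  have hM := isMoorePenroseInverse_moorePenroseInverse G.laplacian
  set M := moorePenroseInverse G.laplacian
  have hMT : M.transpose = M := hM.transpose_eq G.laplacian_transpose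
  have hcomm : (G.laplacian * M).transpose = M * G.laplacian := by
    rw [transpose_mul, hMT, laplacian_transpose]
  have hker : G.laplacian * (M * G.laplacian - 1) = 0 := by
    rw [Matrix.mul_sub, ← Matrix.mul_assoc, hM.mul_mul_left, Matrix.mul_one, sub_self]
  have hcol : ∀ i j k, (M * G.laplacian - 1) i k = (M * G.laplacian - 1) j k := by
    intro i j k
    refine eq_of_laplacian_mulVec_eq_zero hG (f := fun i => (M * G.laplacian - 1) i k) ?_ i j
    ext l
    exact congrFun (congrFun hker l) k
  rw [mulVec_mulVec]
  have hrow : (G.laplacian * M - 1) *ᵥ d = 0 := by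
    have e : G.laplacian * M - 1 = (M * G.laplacian - 1).transpose := by
      rw [← hcomm, transpose_sub, transpose_transpose, transpose_one]
    ext k
    rw [e]
    simp only [mulVec, dotProduct, transpose_apply, Pi.zero_apply]
    rw [Finset.sum_congr rfl fun i _ => by rw [hcol i k k], ← Finset.mul_sum, hd, mul_zero]
  rw [sub_mulVec, one_mulVec, sub_eq_zero] at hrow
  exact hrow

theorem dotProduct_pinv_nonneg (hG : G.graph.Connected) {d : V → ℝ} (hd : ∑ i, d i = 0) :
    0 ≤ d ⬝ᵥ (moorePenroseInverse G.laplacian *ᵥ d) := by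
  have h := G.dotProduct_laplacian_mulVec_self_nonneg (moorePenroseInverse G.laplacian *ᵥ d)
  rwa [laplacian_mulVec_pinv hG hd, dotProduct_comm] at h

theorem eq_zero_of_dotProduct_pinv_nonpos (hG : G.graph.Connected) {d : V → ℝ}
    (hd : ∑ i, d i = 0) (h : d ⬝ᵥ (moorePenroseInverse G.laplacian *ᵥ d) ≤ 0) : d = 0 := by
  set v := moorePenroseInverse G.laplacian *ᵥ d with hv
  have hQ : G.laplacian *ᵥ v = d := laplacian_mulVec_pinv hG hd
  have hc := eq_of_dotProduct_laplacian_mulVec_nonpos hG (g := v) (f := v)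
    (fun i j _ => (sq _).le) (by rwa [hQ, dotProduct_comm])
  rw [← hQ]
  ext i
  rw [laplacian_mulVec]
  exact Finset.sum_eq_zero fun j _ => by rw [hc i j, sub_self, mul_zero]

end Laplacian

/-! ### Effective resistances, potentials and cut nodes -/

section Resistance

variable {V : Type*} [Fintype V] [DecidableEq V] (G : WeightedGraph V)

theorem pinv_symm (i j : V) :
    moorePenroseInverse G.laplacian i j = moorePenroseInverse G.laplacian j i :=
  congrFun (congrFun ((isMoorePenroseInverse_moorePenroseInverse G.laplacian).transpose_eq
    G.laplacian_transpose) j) i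

theorem resistance_eq (i j : V) :
    G.resistance i j = moorePenroseInverse G.laplacian i i +
      moorePenroseInverse G.laplacian j j - 2 * moorePenroseInverse G.laplacian i j := by
  simp only [resistance, mulVec_sub, sub_dotProduct, dotProduct_sub, single_one_dotProduct,
    mulVec_single_one, col_apply]
  rw [G.pinv_symm j i]
  ring

theorem resistance_self (i : V) : G.resistance i i = 0 := by
  rw [resistance_eq]; ring

theorem resistance_comm (i j : V) : G.resistance i j = G.resistance j i := by
  rw [resistance_eq, resistance_eq, G.pinv_symm i j]; ring

theorem sum_single_sub_single (i j : V) :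
    ∑ k, (Pi.single i 1 - Pi.single j 1 : V → ℝ) k = 0 := by
  simp [Finset.sum_sub_distrib]

/-- The potential of the unit current flow from `b` to `x`, grounded at `x`. -/
noncomputable def potential (b x : V) (i : V) : ℝ :=
  (moorePenroseInverse G.laplacian *ᵥ (Pi.single b 1 - Pi.single x 1 : V → ℝ)) i -
    (moorePenroseInverse G.laplacian *ᵥ (Pi.single b 1 - Pi.single x 1 : V → ℝ)) x

theorem potential_eq (b x a : V) :
    2 * G.potential b x a =
      G.resistance a x + G.resistance x b - G.resistance a b := by
  simp only [potential, resistance_eq, mulVec_sub, mulVec_single_one, Pi.sub_apply, col_apply]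
  rw [G.pinv_symm x b]
  rw [G.pinv_symm b x]
  ring

theorem potential_sink (b x : V) : G.potential b x x = 0 := sub_self _

theorem potential_source (b x : V) : G.potential b x b = G.resistance b x := by
  have h := G.potential_eq b x b
  rw [resistance_self, G.resistance_comm x b] at h
  linarith

variable {G}

theorem resistance_pos (hG : G.graph.Connected) {i j : V} (hij : i ≠ j) :
    0 < G.resistance i j := by
  by_contra h
  have h0 := eq_zero_of_dotProduct_pinv_nonpos hG (sum_single_sub_single i j) (not_lt.1 h)
  have := congrFun h0 i
  simp [hij] at this

theorem sum_weight_mul_potential (hG : G.graph.Connected) (b x i : V) :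
    ∑ j, G.weight i j * (G.potential b x i - G.potential b x j) =
      (Pi.single b 1 - Pi.single x 1 : V → ℝ) i := by
  rw [← congrFun (laplacian_mulVec_pinv hG (sum_single_sub_single b x)) i, laplacian_mulVec]
  exact Finset.sum_congr rfl fun j _ => by simp only [potential]; ring

theorem laplacian_mulVec_potential (hG : G.graph.Connected) (b x : V) :
    G.laplacian *ᵥ G.potential b x = Pi.single b 1 - Pi.single x 1 := by
  ext i
  rw [laplacian_mulVec, sum_weight_mul_potential hG]

theorem potential_nonneg (hG : G.graph.Connected) (b x i : V) : 0 ≤ G.potential b x i := by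
  set f := G.potential b x with hf
  have hx : f x = 0 := G.potential_sink b x
  -- Minimum principle: the negative part of `f` vanishes at the sink and is nonpositive at the
  -- source, so its energy pairing with `f` is nonpositive.
  have hc := eq_of_dotProduct_laplacian_mulVec_nonpos hG (g := fun i => min (f i) 0) (f := f)
    (fun i j _ => by
      rcases le_total (f i) 0 with hi | hi <;> rcases le_total (f j) 0 with hj | hj <;>
        simp only [min_eq_left, min_eq_right, hi, hj] <;>
        first
          | exact (sq _).le
          | nlinarith [mul_nonneg (neg_nonneg.2 hi) hj]
          | nlinarith [mul_nonneg hi (neg_nonneg.2 hj)]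
          | simp)
    (by
      rw [hf, laplacian_mulVec_potential hG, dotProduct_sub, dotProduct_single_one,
        dotProduct_single_one, ← hf, hx, min_self, sub_zero]
      exact min_le_right _ _) i x
  simp only [hx, min_self] at hc
  exact min_eq_right_iff.1 hc

theorem resistance_triangle (hG : G.graph.Connected) (a x b : V) :
    G.resistance a b ≤ G.resistance a x + G.resistance x b := by
  linarith [G.potential_eq b x a, potential_nonneg hG b x a]

/-- Equality puts `a` at potential zero. By Kirchhoff's law and nonnegativity, zero spreads from any
node other than `b` and `x` to all its neighbours. A walk avoiding `x` would carry it to `b`, whose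
potential is positive. -/
theorem mem_support_of_resistance_add_eq (hG : G.graph.Connected) {a x b : V} (hxb : x ≠ b)
    (h : G.resistance a x + G.resistance x b = G.resistance a b) (w : G.graph.Walk a b) :
    x ∈ w.support := by
  by_contra hx
  have key : ∀ {u v : V} (w : G.graph.Walk u v), x ∉ w.support → G.potential b x u = 0 →
      G.potential b x v = 0 := by
    intro u v w
    induction w with
    | nil => exact fun _ h => h
    | @cons u v _ huv w ih =>
      intro hx hu
      rw [SimpleGraph.Walk.support_cons, List.mem_cons, not_or] at hx
      refine ih hx.2 ?_
      have hub : u ≠ b := by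
        rintro rfl
        exact (resistance_pos hG hxb).ne' (by
          rw [resistance_comm, ← potential_source, hu])
      have hs := sum_weight_mul_potential hG b x u
      simp only [hu, Pi.sub_apply, Pi.single_eq_of_ne hub, Pi.single_eq_of_ne (Ne.symm hx.1),
        zero_sub, mul_neg, Finset.sum_neg_distrib, neg_zero, neg_eq_zero] at hs
      have h1 := (Finset.sum_eq_zero_iff_of_nonneg fun j _ =>
        mul_nonneg (G.weight_nonneg u j) (potential_nonneg hG b x j)).1 hs v (Finset.mem_univ v)
      exact (mul_eq_zero.1 h1).resolve_left (G.weight_pos u v huv).ne'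
  have hb := key w hx (by linarith [G.potential_eq b x a])
  rw [potential_source] at hb
  exact (resistance_pos hG hxb.symm).ne' hb

/-- Resistances add up at a node `x` that cuts a set `S` containing `a` off from `b`. -/
theorem resistance_add_eq_of_separates (hG : G.graph.Connected) {a x b : V} {S : Set V}
    (ha : a ∈ S) (hx : x ∉ S) (hb : b ∉ S)
    (hS : ∀ i ∈ S, ∀ j ∉ S, G.graph.Adj i j → j = x) :
    G.resistance a x + G.resistance x b = G.resistance a b := by
  set f := G.potential b x with hf
  have hfx : f x = 0 := G.potential_sink b x
  -- Links leaving `S` end at `x`, where `f` is zero, so cutting `f` off outside `S` creates no new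
  -- drop. Source and sink both lie outside `S`.
  have hc := eq_of_dotProduct_laplacian_mulVec_nonpos hG (g := S.indicator f) (f := f)
    (fun i j hij => by
      by_cases hi : i ∈ S <;> by_cases hj : j ∈ S
      · simp only [Set.indicator_of_mem hi, Set.indicator_of_mem hj, sq, le_refl]
      · obtain rfl := hS i hi j hj hij
        simp only [Set.indicator_of_mem hi, Set.indicator_of_notMem hj, hfx, sq, le_refl]
      · obtain rfl := hS j hj i hi hij.symm
        simp only [Set.indicator_of_notMem hi, Set.indicator_of_mem hj, hfx, sq, le_refl]
      · simp [Set.indicator_of_notMem hi, Set.indicator_of_notMem hj])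
    (by
      rw [hf, laplacian_mulVec_potential hG, dotProduct_sub, dotProduct_single_one,
        dotProduct_single_one, Set.indicator_of_notMem hx, Set.indicator_of_notMem hb, sub_zero])
    a x
  rw [Set.indicator_of_mem ha, Set.indicator_of_notMem hx] at hc
  linarith [G.potential_eq b x a]

end Resistance

/-! ### Path graphs and additivity of resistance -/

section Path

variable {V : Type*} [Fintype V] [DecidableEq V] {G : WeightedGraph V}

theorem IsPathWithEnds.resistance_add_eq (hG : G.graph.Connected) {a b : V}
    (h : G.IsPathWithEnds a b) {x : V} (hxa : x ≠ a) :
    G.resistance a x + G.resistance x b = G.resistance a b := by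
  obtain ⟨n, e, rfl, rfl⟩ := h
  obtain ⟨k, rfl⟩ := e.surjective x
  -- The nodes strictly before `x` on the path can be left only through `x`.
  refine resistance_add_eq_of_separates hG (S := {v | e.symm v < k}) ?_ ?_ ?_ ?_
  · simpa using Fin.pos_iff_ne_zero.2 fun h => hxa (congrArg e h)
  · simp
  · simpa using Fin.le_last k
  · intro i hi j hj hij
    rw [← e.symm.map_adj_iff, SimpleGraph.pathGraph_adj] at hij
    simp only [Set.mem_ofPred_eq, not_lt] at hi hj
    have : e.symm j = k := by
      rw [Fin.lt_def] at hi
      rw [Fin.le_def] at hj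
      ext
      omega
    rw [← this, e.apply_symm_apply]

theorem isPathWithEnds_of_resistance_add_eq (hG : G.graph.Connected) {a b : V}
    (h : ∀ x : V, x ≠ a → x ≠ b →
      G.resistance a x + G.resistance x b = G.resistance a b) :
    G.IsPathWithEnds a b := by
  obtain ⟨w, hw, hlen⟩ := hG.exists_path_of_dist a b
  have hsupp : ∀ x, x ∈ w.support := by
    intro x
    by_cases hxa : x = a
    · exact hxa ▸ w.start_mem_support
    by_cases hxb : x = b
    · exact hxb ▸ w.end_mem_support
    exact mem_support_of_resistance_add_eq hG hxb (h x hxa hxb) w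
  have hinj : Function.Injective fun i : Fin (w.length + 1) => w.getVert i := fun i j hij =>
    Fin.ext (hw.getVert_injOn (Nat.lt_succ_iff.1 i.2) (Nat.lt_succ_iff.1 j.2) hij)
  have hsurj : Function.Surjective fun i : Fin (w.length + 1) => w.getVert i := by
    intro x
    obtain ⟨m, hm, hle⟩ := SimpleGraph.Walk.mem_support_iff_exists_getVert.1 (hsupp x)
    exact ⟨⟨m, Nat.lt_succ_of_le hle⟩, hm⟩
  -- A chord would shortcut the shortest path `w`.
  have hchord : ∀ i j : ℕ, i < j → j ≤ w.length → G.graph.Adj (w.getVert i) (w.getVert j) →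
      i + 1 = j := by
    intro i j hij hj hadj
    have hd := SimpleGraph.dist_le ((w.take i).append (SimpleGraph.Walk.cons hadj (w.drop j)))
    rw [← hlen, SimpleGraph.Walk.length_append, SimpleGraph.Walk.length_cons,
      SimpleGraph.Walk.take_length, SimpleGraph.Walk.drop_length] at hd
    omega
  refine ⟨w.length, ⟨Equiv.ofBijective _ ⟨hinj, hsurj⟩, ?_⟩, ?_, ?_⟩
  · intro i j
    rw [SimpleGraph.pathGraph_adj]
    change G.graph.Adj (w.getVert i) (w.getVert j) ↔ _
    constructor
    · intro hadj
      rcases lt_trichotomy i.val j.val with hij | hij | hij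
      · exact Or.inl (hchord i j hij (Nat.lt_succ_iff.1 j.2) hadj)
      · rw [hij] at hadj
        exact absurd hadj G.graph.irrefl
      · exact Or.inr (hchord j i hij (Nat.lt_succ_iff.1 i.2) hadj.symm)
    · rintro (hij | hij)
      · rw [← hij]
        exact w.adj_getVert_succ (by omega)
      · rw [← hij]
        exact (w.adj_getVert_succ (by omega)).symm
  · exact w.getVert_zero
  · exact w.getVert_length

end Path

/-! ### Concavity of the variance and first-order conditions -/

section Variance

variable {V : Type*} [Fintype V] [DecidableEq V] (G : WeightedGraph V)

/-- The mean resistance from node `i` to a node drawn from `p`. -/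
noncomputable def meanResistance (p : V → ℝ) (i : V) : ℝ := ∑ j, p j * G.resistance i j

theorem variance_eq (p : V → ℝ) : G.variance p = (1 / 2) * ∑ i, p i * G.meanResistance p i := by
  simp only [variance, meanResistance, Finset.mul_sum, mul_assoc]

theorem sum_mul_meanResistance_comm (p q : V → ℝ) :
    ∑ i, p i * G.meanResistance q i = ∑ i, q i * G.meanResistance p i := by
  simp only [meanResistance, Finset.mul_sum]
  rw [Finset.sum_comm]
  exact Finset.sum_congr rfl fun i _ => Finset.sum_congr rfl fun j _ => by
    rw [G.resistance_comm]; ring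

/-- In `resistance_eq` the two diagonal terms each depend on one index only and cancel against the
zero sum; the cross term remains. -/
theorem sum_mul_meanResistance_self {d : V → ℝ} (hd : ∑ i, d i = 0) :
    ∑ i, d i * G.meanResistance d i =
      -2 * (d ⬝ᵥ (moorePenroseInverse G.laplacian *ᵥ d)) := by
  set M := moorePenroseInverse G.laplacian with hM
  have hm : ∀ i, G.meanResistance d i = ∑ j, d j * M j j - 2 * (M *ᵥ d) i := by
    intro i
    have h : ∀ j, d j * G.resistance i j = M i i * d j + d j * M j j - 2 * (M i j * d j) := by
      intro j
      rw [resistance_eq, ← hM]; ring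
    simp only [meanResistance, h, Finset.sum_sub_distrib, Finset.sum_add_distrib,
      ← Finset.mul_sum, hd, mulVec, dotProduct]
    ring
  have h2 : ∀ i, d i * G.meanResistance d i =
      d i * (∑ j, d j * M j j) + -2 * (d i * (M *ᵥ d) i) := fun i => by rw [hm i]; ring
  rw [Finset.sum_congr rfl fun i _ => h2 i, Finset.sum_add_distrib, ← Finset.sum_mul, hd,
    zero_mul, zero_add, ← Finset.mul_sum]
  rfl

theorem variance_add_smul (p : V → ℝ) {d : V → ℝ} (hd : ∑ i, d i = 0) (t : ℝ) :
    G.variance (p + t • d) = G.variance p + t * ∑ i, d i * G.meanResistance p i -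
      t ^ 2 * (d ⬝ᵥ (moorePenroseInverse G.laplacian *ᵥ d)) := by
  have hm : ∀ i, G.meanResistance (p + t • d) i =
      G.meanResistance p i + t * G.meanResistance d i := by
    intro i
    simp only [meanResistance, Pi.add_apply, Pi.smul_apply, smul_eq_mul, add_mul,
      Finset.sum_add_distrib, Finset.mul_sum, mul_assoc]
  have hs : ∑ i, (p + t • d) i * G.meanResistance (p + t • d) i =
      ∑ i, p i * G.meanResistance p i + t * ∑ i, p i * G.meanResistance d i +
        t * ∑ i, d i * G.meanResistance p i + t ^ 2 * ∑ i, d i * G.meanResistance d i := by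
    simp only [hm, Pi.add_apply, Pi.smul_apply, smul_eq_mul, Finset.mul_sum,
      ← Finset.sum_add_distrib]
    exact Finset.sum_congr rfl fun i _ => by ring
  rw [variance_eq, variance_eq, hs, G.sum_mul_meanResistance_comm p d,
    G.sum_mul_meanResistance_self hd]
  ring

variable {G}

theorem exists_isMaxVarianceDistribution [Nonempty V] :
    ∃ p, G.IsMaxVarianceDistribution p := by
  have hcont : Continuous G.variance := by
    unfold variance
    fun_prop
  obtain ⟨p, hp, hmax⟩ := (isCompact_stdSimplex ℝ V).exists_isMaxOn
    ⟨_, single_mem_stdSimplex ℝ (Classical.arbitrary V)⟩ hcont.continuousOn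
  exact ⟨p, hp, fun q hq => hmax hq⟩

theorem IsMaxVarianceDistribution.sum_mul_meanResistance_nonpos (hG : G.graph.Connected)
    {p q : V → ℝ} (hp : G.IsMaxVarianceDistribution p) (hq : q ∈ stdSimplex ℝ V) :
    ∑ i, (q - p) i * G.meanResistance p i ≤ 0 := by
  have hd := sum_sub_eq_zero_of_mem_stdSimplex hp.1 hq
  set D := (q - p) ⬝ᵥ (moorePenroseInverse G.laplacian *ᵥ (q - p)) with hD
  have hD0 : 0 ≤ D := dotProduct_pinv_nonneg hG hd
  set L := ∑ i, (q - p) i * G.meanResistance p i with hL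
  have key : ∀ t : ℝ, 0 < t → t ≤ 1 → L ≤ t * D := by
    intro t ht0 ht1
    have hmem : p + t • (q - p) ∈ stdSimplex ℝ V :=
      (convex_stdSimplex ℝ V).add_smul_sub_mem hp.1 hq ⟨ht0.le, ht1⟩
    have h := hp.2 _ hmem
    rw [variance_add_smul G p hd t, ← hL, ← hD] at h
    have : t * L ≤ t * (t * D) := by nlinarith
    exact le_of_mul_le_mul_left this ht0
  by_contra! hpos
  have h1 := key 1 one_pos le_rfl
  have hDpos : 0 < D := by linarith
  -- At this `t`, which is at most 1 by `h1`, `key` reads `L ≤ L / 2`.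
  have h2 := key (L / (2 * D)) (by positivity) (by rw [div_le_one (by positivity)]; linarith)
  rw [div_mul_eq_mul_div, mul_div_mul_right _ _ hDpos.ne'] at h2
  linarith

theorem IsMaxVarianceDistribution.unique (hG : G.graph.Connected)
    {p q : V → ℝ} (hp : G.IsMaxVarianceDistribution p) (hq : G.IsMaxVarianceDistribution q) :
    q = p := by
  have hd := sum_sub_eq_zero_of_mem_stdSimplex hp.1 hq.1
  have h1 := hp.sum_mul_meanResistance_nonpos hG hq.1
  have h2 := variance_add_smul G p hd 1
  rw [one_smul, add_sub_cancel] at h2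
  have h3 := hq.2 p hp.1
  exact sub_eq_zero.1 (eq_zero_of_dotProduct_pinv_nonpos hG hd (by linarith))

/-- By concavity the first-order conditions suffice: averaging them over `q` makes the linear term
nonpositive. -/
theorem isMaxVarianceDistribution_of_meanResistance_le (hG : G.graph.Connected) {p : V → ℝ}
    (hp : p ∈ stdSimplex ℝ V)
    (h : ∀ i, G.meanResistance p i ≤ ∑ j, p j * G.meanResistance p j) :
    G.IsMaxVarianceDistribution p := by
  refine ⟨hp, fun q hq => ?_⟩
  have hd := sum_sub_eq_zero_of_mem_stdSimplex hp hq
  have h2 := variance_add_smul G p hd 1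
  rw [one_smul, add_sub_cancel] at h2
  have h3 := dotProduct_pinv_nonneg hG hd
  have h4 : ∑ i, q i * G.meanResistance p i ≤ ∑ j, p j * G.meanResistance p j := by
    calc _ ≤ ∑ i, q i * ∑ j, p j * G.meanResistance p j :=
          Finset.sum_le_sum fun i _ => mul_le_mul_of_nonneg_left (h i) (hq.1 i)
      _ = _ := by rw [← Finset.sum_mul, hq.2, one_mul]
  have h5 : ∑ i, (q - p) i * G.meanResistance p i =
      ∑ i, q i * G.meanResistance p i - ∑ i, p i * G.meanResistance p i := by
    simp only [Pi.sub_apply, sub_mul, Finset.sum_sub_distrib]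
  linarith

theorem IsMaxVarianceDistribution.meanResistance_le (hG : G.graph.Connected) {p : V → ℝ}
    (hp : G.IsMaxVarianceDistribution p) (i : V) :
    G.meanResistance p i ≤ ∑ j, p j * G.meanResistance p j := by
  have h := hp.sum_mul_meanResistance_nonpos hG (single_mem_stdSimplex ℝ i)
  simp only [Pi.sub_apply, sub_mul, Finset.sum_sub_distrib] at h
  have e : ∑ j, (Pi.single i 1 : V → ℝ) j * G.meanResistance p j = G.meanResistance p i :=
    single_one_dotProduct _ _
  linarith

theorem sum_mul_eq_of_support {p : V → ℝ} {a b : V} (hab : a ≠ b)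
    (h0 : ∀ i, i ≠ a → i ≠ b → p i = 0) (f : V → ℝ) :
    ∑ i, p i * f i = p a * f a + p b * f b := by
  rw [← Finset.sum_pair (f := fun i => p i * f i) hab]
  refine (Finset.sum_subset (Finset.subset_univ _) fun i _ hi => ?_).symm
  simp only [Finset.mem_insert, Finset.mem_singleton, not_or] at hi
  rw [h0 i hi.1 hi.2, zero_mul]

theorem IsMaxVarianceDistribution.support_eq_pair_iff (hG : G.graph.Connected) {p : V → ℝ}
    (hp : G.IsMaxVarianceDistribution p) {a b : V} (hab : a ≠ b) :
    {i | 0 < p i} = ({a, b} : Set V) ↔ ∀ x : V, x ≠ a → x ≠ b →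
      G.resistance a x + G.resistance x b = G.resistance a b := by
  constructor
  · intro hS x _ _
    have hmem : ∀ i, 0 < p i ↔ i = a ∨ i = b := fun i => Set.ext_iff.1 hS i
    have h0 : ∀ i, i ≠ a → i ≠ b → p i = 0 := fun i hia hib =>
      le_antisymm (not_lt.1 fun h => ((hmem i).1 h).elim hia hib) (hp.1.1 i)
    have hpa : 0 < p a := (hmem a).2 (Or.inl rfl)
    have hpb : 0 < p b := (hmem b).2 (Or.inr rfl)
    have hsum : p a + p b = 1 := by
      have := sum_mul_eq_of_support hab h0 fun _ => 1
      simpa [hp.1.2] using this.symm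
    have hm : ∀ i, G.meanResistance p i = p a * G.resistance i a + p b * G.resistance i b :=
      fun i => sum_mul_eq_of_support hab h0 _
    have hle := hp.meanResistance_le hG
    simp only [sum_mul_eq_of_support hab h0, hm, resistance_self, G.resistance_comm b a, mul_zero,
      zero_add, add_zero] at hle
    have hR := resistance_pos hG hab
    have hla := hle a
    have hlb := hle b
    have hlx := hle x
    simp only [resistance_self, G.resistance_comm b a, mul_zero, zero_add, add_zero] at hla hlb
    -- The condition at `a` is `p b * R ≤ 2 * p a * p b * R` with `R = G.resistance a b`; cancel `p
    -- b * R`.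
    have ha : 1 ≤ 2 * p a := by
      have : (p b * G.resistance a b) * 1 ≤ (p b * G.resistance a b) * (2 * p a) := by linarith
      exact le_of_mul_le_mul_left this (by positivity)
    have hb : 1 ≤ 2 * p b := by
      have : (p a * G.resistance a b) * 1 ≤ (p a * G.resistance a b) * (2 * p b) := by linarith
      exact le_of_mul_le_mul_left this (by positivity)
    have ea : p a = 1 / 2 := by linarith
    have eb : p b = 1 / 2 := by linarith
    -- The condition at `x` is now the reverse triangle inequality.
    rw [ea, eb, G.resistance_comm x a] at hlx
    linarith [resistance_triangle hG a x b]
  · intro h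
    -- For the fair distribution on `a, b`, every node has mean resistance `G.resistance a b / 2`,
    -- so all first-order conditions hold with equality.
    set q : V → ℝ := fun i => if i = a ∨ i = b then 1 / 2 else 0 with hq
    have hqa : q a = 1 / 2 := by simp [hq]
    have hqb : q b = 1 / 2 := by simp [hq]
    have h0 : ∀ i, i ≠ a → i ≠ b → q i = 0 := fun i hia hib => by simp [hq, hia, hib]
    have hmem : q ∈ stdSimplex ℝ V := by
      refine ⟨fun i => by simp only [hq]; split_ifs <;> norm_num, ?_⟩
      have := sum_mul_eq_of_support hab h0 fun _ => 1
      simp only [mul_one, hqa, hqb] at this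
      rw [this]; norm_num
    have hm : ∀ i, G.meanResistance q i = q a * G.resistance i a + q b * G.resistance i b :=
      fun i => sum_mul_eq_of_support hab h0 _
    have hmax : G.IsMaxVarianceDistribution q := by
      refine isMaxVarianceDistribution_of_meanResistance_le hG hmem fun i => ?_
      simp only [sum_mul_eq_of_support hab h0, hm, hqa, hqb, resistance_self,
        G.resistance_comm b a, mul_zero, zero_add, add_zero]
      by_cases hia : i = a
      · subst hia; rw [resistance_self]; linarith
      by_cases hib : i = b
      · subst hib; rw [resistance_self, G.resistance_comm i a]; linarith
      rw [G.resistance_comm i a]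
      linarith [h i hia hib]
    rw [← hp.unique hG hmax]
    ext i
    simp only [hq, Set.mem_ofPred_eq, Set.mem_insert_iff, Set.mem_singleton_iff]
    split_ifs with hi <;> simp [hi]

end Variance

end WeightedGraph

theorem mainTheorem9 {V : Type*} [Fintype V] [DecidableEq V] (G : WeightedGraph V)
    (hG : G.graph.Connected) :
    ∃ p : V → ℝ, G.IsMaxVarianceDistribution p ∧
      (∀ q : V → ℝ, G.IsMaxVarianceDistribution q → q = p) ∧
      (∀ a b : V, a ≠ b →
        (({i | 0 < p i} : Set V) = {a, b} ↔ G.IsPathWithEnds a b) ∧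
        (({i | 0 < p i} : Set V) = {a, b} ↔
          ∀ x : V, x ≠ a → x ≠ b →
            G.resistance a x + G.resistance x b = G.resistance a b)) ∧
      (({i | 0 < p i} : Set V).ncard = 2 ↔ ∃ a b : V, a ≠ b ∧ G.IsPathWithEnds a b) := by
  have := hG.nonempty
  obtain ⟨p, hp⟩ := WeightedGraph.exists_isMaxVarianceDistribution (G := G)
  have hpath : ∀ a b : V, a ≠ b →
      (({i | 0 < p i} : Set V) = {a, b} ↔ G.IsPathWithEnds a b) := fun a b hab =>
    (hp.support_eq_pair_iff hG hab).trans
      ⟨WeightedGraph.isPathWithEnds_of_resistance_add_eq hG,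
        fun h _ hxa _ => h.resistance_add_eq hG hxa⟩
  refine ⟨p, hp, fun q hq => hp.unique hG hq,
    fun a b hab => ⟨hpath a b hab, hp.support_eq_pair_iff hG hab⟩, ?_⟩
  rw [Set.ncard_eq_two]
  exact exists_congr fun a => exists_congr fun b => and_congr_right fun hab => hpath a b hab
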